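/- Let $K$ be a commutative noetherian ring with unity, let $c\ge 0$ be an integer, write $\mathbb{N}=\{1,2,\dots\}$ and $[c]=\{1,\dots,c\}$, and consider the polynomial ring $$K[X]=K[x_{i,j}\mid i\in[c],\ j\in\mathbb{N}].$$ Let $\mathrm{Inc}$ be the monoid, under composition, of maps $\pi\colon\mathbb{N}\to\mathbb{N}$ with $\pi(j)<\pi(j+1)$ for all $j\ge 1$, and let $\mathrm{Sym}(\infty)=\bigcup_{n}\mathrm{Sym}(n)$ be the group of permutations $\pi$ of $\mathbb{N}$ for which there is some $n$ such that $\pi(m)=m$ for all $m>n$. Both act on $K[X]$ by $K$-algebra endomorphisms determined by $\pi\cdot x_{i,j}=x_{i,\pi(j)}$. If $\Pi$ is one of these two monoids, then an ideal $I$ of $K[X]$ is called $\Pi$-invariant if $\pi\cdot f\in I$ for all $\pi\in\Pi$ and $f\in I$, and $K[X]$ is called $\Pi$-noetherian if for every $\Pi$-invariant ideal $I$ there are finitely many elements $f_1,\dots,f_s\in I$ such that $I$ is generated, as an ideal, by the union of the orbits $\Pi\cdot f_1,\dots,\Pi\cdot f_s$. Then: 1. $K[X]$ is $\mathrm{Inc}$-noetherian.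 2. $K[X]$ is $\mathrm{Sym}(\infty)$-noetherian. -/

import Mathlib

namespace EquivariantNoeth

/-- The monoid `Inc` of strictly increasing maps `π : ℕ → ℕ`, where `ℕ = {1, 2, …}`;
multiplication is composition of maps. -/
def Inc : Submonoid (Function.End ℕ+) where
  carrier := {π | StrictMono (π : ℕ+ → ℕ+)}
  one_mem' := strictMono_id
  mul_mem' := fun {a b} ha hb => StrictMono.comp (g := a) (f := b) ha hb

theorem mem_Inc_iff (π : Function.End ℕ+) : π ∈ Inc ↔ ∀ i : ℕ+, π i < π (i + 1) := by
  refine ⟨fun h i => h (PNat.lt_add_right i 1), fun h a b hab => ?_⟩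
  induction b using PNat.recOn with
  | one => exact absurd hab not_lt_one
  | succ b ih =>
    rcases (PNat.lt_add_one_iff.mp hab).eq_or_lt with rfl | hlt
    · exact h a
    · exact (ih hlt).trans (h b)

/-- The group `Sym(∞) = ⋃ₙ Sym(n)`: the permutations `σ` of `ℕ = {1, 2, …}` for which there is
some `n` such that `σ` fixes every `m > n`; multiplication is composition. -/
def SymInf : Subgroup (Equiv.Perm ℕ+) where
  carrier := {σ | ∃ n : ℕ+, ∀ m : ℕ+, n < m → σ m = m}
  one_mem' := ⟨1, fun _ _ => rfl⟩
  mul_mem' := by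
    rintro a b ⟨n, hn⟩ ⟨k, hk⟩
    refine ⟨max n k, fun m hm => ?_⟩
    rw [Equiv.Perm.mul_apply, hk m (lt_of_le_of_lt (le_max_right _ _) hm),
      hn m (lt_of_le_of_lt (le_max_left _ _) hm)]
  inv_mem' := by
    rintro a ⟨n, hn⟩
    exact ⟨n, fun m hm => by rw [Equiv.Perm.inv_eq_iff_eq, hn m hm]⟩

/-- The polynomial ring `K[X] = K[x_{i,j} | i ∈ [c], j ∈ ℕ]`, with `ℕ = {1, 2, …}`. -/
abbrev PolyRing (c : ℕ) (K : Type*) [CommRing K] : Type _ :=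
  MvPolynomial (Fin c × ℕ+) K

/-- The action of the monoid of all maps `π : ℕ → ℕ` on `K[X]` by `K`-algebra endomorphisms
determined by `π · x_{i,j} = x_{i,π(j)}`. -/
noncomputable def mapAction (c : ℕ) (K : Type*) [CommRing K] :
    Function.End ℕ+ →* (PolyRing c K →ₐ[K] PolyRing c K) where
  toFun π := MvPolynomial.rename (fun p : Fin c × ℕ+ => (p.1, π p.2))
  map_one' := by
    apply MvPolynomial.algHom_ext
    intro p
    rw [MvPolynomial.rename_X]
    rfl
  map_mul' a b := by
    apply MvPolynomial.algHom_ext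
    intro p
    rw [AlgHom.mul_apply, MvPolynomial.rename_X, MvPolynomial.rename_X, MvPolynomial.rename_X]
    rfl

/-- The action of `Inc` on `K[X]`, `π · x_{i,j} = x_{i,π(j)}`. -/
noncomputable def incAction (c : ℕ) (K : Type*) [CommRing K] :
    Inc →* (PolyRing c K →ₐ[K] PolyRing c K) :=
  (mapAction c K).comp Inc.subtype

/-- The action of `Sym(∞)` on `K[X]`, `σ · x_{i,j} = x_{i,σ(j)}`. -/
noncomputable def symAction (c : ℕ) (K : Type*) [CommRing K] :
    SymInf →* (PolyRing c K →ₐ[K] PolyRing c K) :=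
  (mapAction c K).comp ((MulAction.toEndHom (M := Equiv.Perm ℕ+) (α := ℕ+)).comp SymInf.subtype)

theorem incAction_X (c : ℕ) (K : Type*) [CommRing K] (π : Inc) (i : Fin c) (j : ℕ+) :
    incAction c K π (MvPolynomial.X (i, j)) = MvPolynomial.X (i, π.1 j) :=
  MvPolynomial.rename_X _ _

theorem symAction_X (c : ℕ) (K : Type*) [CommRing K] (σ : SymInf) (i : Fin c) (j : ℕ+) :
    symAction c K σ (MvPolynomial.X (i, j)) = MvPolynomial.X (i, σ.1 j) :=
  MvPolynomial.rename_X _ _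

/-- The orbit of an element `f` of a `K`-algebra `A` under the action `ρ` of a monoid `M`. -/
def orbit {K A M : Type*} [CommRing K] [CommRing A] [Algebra K A] [Monoid M]
    (ρ : M →* (A →ₐ[K] A)) (f : A) : Set A :=
  Set.range fun π : M => ρ π f

/-- An ideal `I` is invariant if `π · f ∈ I` for all `π ∈ M` and all `f ∈ I`. -/
def IsInvariant {K A M : Type*} [CommRing K] [CommRing A] [Algebra K A] [Monoid M]
    (ρ : M →* (A →ₐ[K] A)) (I : Ideal A) : Prop :=
  ∀ π : M, ∀ f ∈ I, ρ π f ∈ I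

/-- A `K`-algebra `A` with an action `ρ` of a monoid `M` is `M`-noetherian if every `M`-invariant
ideal of `A` is generated, as an ideal, by the `M`-orbits of finitely many elements. -/
def IsEquivariantlyNoetherian {K A M : Type*} [CommRing K] [CommRing A] [Algebra K A] [Monoid M]
    (ρ : M →* (A →ₐ[K] A)) : Prop :=
  ∀ I : Ideal A, IsInvariant ρ I → ∃ s : Finset A, I = Ideal.span (⋃ f ∈ s, orbit ρ f)

end EquivariantNoeth

/-! A Gröbner basis argument. Suppose no finite set of orbits generates `I`, and repeatedly choose
`f n` in `I` of least degree outside the ideal generated by the orbits of the earlier choices. By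
Higman's lemma, along a subsequence each leading monomial can be moved by `Inc` to a divisor of
every later one. As `K` is noetherian, some leading coefficient is a combination of earlier ones;
subtracting the matching combination of shifted earlier terms cancels the leading term and
contradicts minimality (`exists_finset_eq_span_rename`). The symmetric case follows, since on a
single polynomial `Inc` acts through elements of `Sym(∞)` (`exists_symAction_eq_incAction`). -/

namespace EquivariantNoeth

open MvPolynomial

/-! ### Abstract equivariant basis theorem -/

/-- In a noetherian ring, every sequence has a term that is a combination of earlier terms. -/
theorem exists_mem_span_image_range {K : Type*} [CommRing K] [IsNoetherianRing K] (a : ℕ → K) :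
    ∃ n, a n ∈ Ideal.span (a '' (Finset.range n : Set ℕ)) := by
  let F : ℕ →o Ideal K :=
    ⟨fun n => Ideal.span (a '' (Finset.range n : Set ℕ)), fun i j hij =>
      Ideal.span_mono (Set.image_mono (by
        exact_mod_cast Finset.range_mono hij))⟩
  obtain ⟨n, hn⟩ := monotone_stabilizes_iff_noetherian.mpr ‹IsNoetherianRing K› F
  refine ⟨n, ?_⟩
  have h : F n = F (n + 1) := hn (n + 1) n.le_succ
  change a n ∈ F n
  rw [h]
  exact Ideal.subset_span ⟨n, by simp, rfl⟩

/-- Renaming the variables along an injective map that is strictly increasing on monomials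
renames the monomials of a polynomial without creating monomials above the renamed degree. -/
theorem degree_rename_le {σ K : Type*} [CommRing K] (m : MonomialOrder σ) (e : σ → σ)
    (hmono : ∀ u v, m.toSyn u < m.toSyn v →
      m.toSyn (u.mapDomain e) < m.toSyn (v.mapDomain e)) (f : MvPolynomial σ K) :
    m.toSyn (m.degree (rename e f)) ≤ m.toSyn ((m.degree f).mapDomain e) := by
  rw [MonomialOrder.degree_le_iff]
  intro d hd
  obtain ⟨u, rfl, hu⟩ := coeff_rename_ne_zero e f d (mem_support_iff.mp hd)
  rcases (m.le_degree (mem_support_iff.mpr hu)).eq_or_lt with h | h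
  · rw [m.toSyn.injective h]
  · exact (hmono _ _ h).le

/-- Suppose that variables are renamed by injective maps `φ π` which are strictly increasing for a
monomial order, and that every sequence of monomials has a subsequence in which each monomial has
a renaming dividing each later one. Then every ideal stable under these renamings is generated by
the renamings of finitely many polynomials. -/
theorem exists_finset_eq_span_rename {σ M K : Type*} [CommRing K] [IsNoetherianRing K]
    (m : MonomialOrder σ) (φ : M → σ → σ) (hinj : ∀ π, Function.Injective (φ π))
    (hmono : ∀ π u v, m.toSyn u < m.toSyn v →
      m.toSyn (u.mapDomain (φ π)) < m.toSyn (v.mapDomain (φ π)))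
    (hsub : ∀ u : ℕ → σ →₀ ℕ, ∃ g : ℕ ↪o ℕ, ∀ k l, k ≤ l →
      ∃ π, (u (g k)).mapDomain (φ π) ≤ u (g l))
    (I : Ideal (MvPolynomial σ K)) (hI : ∀ π, ∀ f ∈ I, rename (φ π) f ∈ I) :
    ∃ s : Finset (MvPolynomial σ K),
      I = Ideal.span (⋃ f ∈ s, Set.range fun π => rename (φ π) f) := by
  classical
  let J : Finset (MvPolynomial σ K) → Ideal (MvPolynomial σ K) := fun s =>
    Ideal.span (⋃ f ∈ s, Set.range fun π => rename (φ π) f)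
  have mem_J : ∀ {s f} (π), f ∈ s → rename (φ π) f ∈ J s := fun π hf =>
    Ideal.subset_span (Set.mem_biUnion hf ⟨π, rfl⟩)
  by_contra! hne
  -- Putting `s ⊆ I` inside the existential makes `next` a total function; its value 0 elsewhere is
  -- never used.
  have hmin : ∀ s : Finset (MvPolynomial σ K), ∃ f, ((∀ h ∈ s, h ∈ I) →
      f ∈ I ∧ f ∉ J s ∧
      ∀ h ∈ I, h ∉ J s → ¬ m.toSyn (m.degree h) < m.toSyn (m.degree f)) := by
    intro s
    by_cases hs : ∀ h ∈ s, h ∈ I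
    · have hle : J s ≤ I := by
        refine Ideal.span_le.mpr (Set.iUnion₂_subset fun f hf => ?_)
        rintro _ ⟨π, rfl⟩
        exact hI π f (hs f hf)
      obtain ⟨f₀, hf₀, hf₀'⟩ := SetLike.not_le_iff_exists.mp fun h => hne s (le_antisymm h hle)
      obtain ⟨f, ⟨hf, hf'⟩, hlt⟩ := (InvImage.wf (fun f : MvPolynomial σ K =>
        m.toSyn (m.degree f)) wellFounded_lt).has_min {f | f ∈ I ∧ f ∉ J s} ⟨f₀, hf₀, hf₀'⟩
      exact ⟨f, fun _ => ⟨hf, hf', fun h hh hh' => hlt h ⟨hh, hh'⟩⟩⟩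
    · exact ⟨0, fun h => absurd h hs⟩
  choose next hnext using hmin
  let S : ℕ → Finset (MvPolynomial σ K) := fun n => n.rec ∅ fun _ s => insert (next s) s
  have S_succ : ∀ n, S (n + 1) = insert (next (S n)) (S n) := fun _ => rfl
  have hSI : ∀ n : ℕ, ∀ h ∈ S n, h ∈ I := by
    intro n
    induction n with
    | zero => simp [S]
    | succ n ih =>
      rw [S_succ, Finset.forall_mem_insert]
      exact ⟨(hnext _ ih).1, ih⟩
  have hS : Monotone S := monotone_nat_of_le_succ fun n => Finset.subset_insert _ _
  let f : ℕ → MvPolynomial σ K := fun n => next (S n)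
  have hfS : ∀ {k l}, k < l → f k ∈ S l := fun {k l} h =>
    hS (Nat.succ_le_of_lt h) (Finset.mem_insert_self _ _)
  have hfI : ∀ n, f n ∈ I := fun n => (hnext _ (hSI n)).1
  obtain ⟨g, hg⟩ := hsub fun n => m.degree (f n)
  obtain ⟨n, hn⟩ := exists_mem_span_image_range fun k => m.leadingCoeff (f (g k))
  obtain ⟨b, hb⟩ := (Submodule.mem_span_image_finset_iff_exists_fun' K).mp hn
  have hg' : ∀ k, ∃ π, k ≤ n → (m.degree (f (g k))).mapDomain (φ π) ≤ m.degree (f (g n)) := by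
    intro k
    by_cases hk : k ≤ n
    · obtain ⟨π, hπ⟩ := hg k n hk
      exact ⟨π, fun _ => hπ⟩
    · obtain ⟨π, -⟩ := hg 0 0 le_rfl
      exact ⟨π, fun h => absurd h hk⟩
  choose π hπ using hg'
  set v := m.degree (f (g n))
  -- Each `p k` has degree at most `v`, and its coefficient at `v` is the `k`-th summand of `hn`, so
  -- `q` matches the leading term of `f (g n)`.
  let p : ℕ → MvPolynomial σ K := fun k =>
    monomial (v - (m.degree (f (g k))).mapDomain (φ (π k))) (b k) * rename (φ (π k)) (f (g k))
  let q := ∑ k ∈ Finset.range n, p k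
  have hp_coeff : ∀ k ∈ Finset.range n, coeff v (p k) = b k * m.leadingCoeff (f (g k)) := by
    intro k hk
    have hle := hπ k (Finset.mem_range.mp hk).le
    have h := coeff_monomial_mul ((m.degree (f (g k))).mapDomain (φ (π k)))
      (v - (m.degree (f (g k))).mapDomain (φ (π k))) (b k) (rename (φ (π k)) (f (g k)))
    rw [tsub_add_cancel_of_le hle, coeff_rename_mapDomain _ (hinj _)] at h
    exact h
  have hp_degree : ∀ k ∈ Finset.range n, m.toSyn (m.degree (p k)) ≤ m.toSyn v := by
    intro k hk
    have hle := hπ k (Finset.mem_range.mp hk).le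
    refine m.toSyn_degree_mul_le.trans ((add_le_add (m.degree_monomial_le _)
      (degree_rename_le m _ (hmono _) _)).trans ?_)
    rw [← map_add, tsub_add_cancel_of_le hle]
  have hqJ : q ∈ J (S (g n)) := Ideal.sum_mem _ fun k hk => Ideal.mul_mem_left _ _
    (mem_J _ (hfS (g.strictMono (Finset.mem_range.mp hk))))
  have hqI : q ∈ I := Ideal.sum_mem _ fun k _ => Ideal.mul_mem_left _ _ (hI _ _ (hfI _))
  obtain ⟨-, hfJ, hleast⟩ := hnext _ (hSI (g n))
  have hr : f (g n) - q ∉ J (S (g n)) := fun h => hfJ ((Submodule.sub_mem_iff_left _ hqJ).mp h)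
  refine hleast _ (sub_mem (hfI _) hqI) hr (lt_of_le_of_ne ?_ fun h => ?_)
  · refine m.degree_sub_le.trans (sup_le le_rfl (m.degree_sum_le.trans (Finset.sup_le ?_)))
    exact hp_degree
  -- If the degree did not drop, the leading coefficient of the difference would be 0, so the
  -- difference would be 0 and lie in `J`.
  · refine hr ?_
    have h0 : coeff v (f (g n) - q) = 0 := by
      rw [coeff_sub, coeff_sum, Finset.sum_congr rfl hp_coeff, sub_eq_zero]
      exact hb.symm
    have hd : m.degree (f (g n) - q) = v := m.toSyn.injective h
    rw [← hd, MonomialOrder.coeff_degree_eq_zero_iff] at h0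
    rw [h0]
    exact zero_mem _

/-! ### A monomial order compatible with `Inc` -/

/-- The monomial order on `K[X]` comparing exponents at the largest variable where they differ,
the variables being ordered by column and then by row. -/
noncomputable def columnOrder (c : ℕ) : MonomialOrder (Fin c × ℕ+) where
  syn := Colex ((ℕ+ ×ₗ Fin c) →₀ ℕ)
  toSyn :=
    (Finsupp.domCongr ((Equiv.prodComm (Fin c) ℕ+).trans toLex)).trans
      ({ toEquiv := toColex, map_add' := fun _ _ => rfl } :
        ((ℕ+ ×ₗ Fin c) →₀ ℕ) ≃+ Colex ((ℕ+ ×ₗ Fin c) →₀ ℕ))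
  toSyn_monotone := fun _ _ h => Finsupp.toColex_monotone (α := ℕ+ ×ₗ Fin c)
    fun p => h ((ofLex p).2, (ofLex p).1)

theorem columnOrder_lt_iff {c : ℕ} {u v : Fin c × ℕ+ →₀ ℕ} :
    (columnOrder c).toSyn u < (columnOrder c).toSyn v ↔
      ∃ p : Fin c × ℕ+, (∀ q : Fin c × ℕ+, (p.2 < q.2 ∨ p.2 = q.2 ∧ p.1 < q.1) → u q = v q) ∧
        u p < v p := by
  refine Finsupp.Colex.lt_iff.trans ⟨?_, ?_⟩
  · rintro ⟨p, hp, hlt⟩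
    exact ⟨((ofLex p).2, (ofLex p).1),
      fun q hq => hp (toLex (q.2, q.1)) (Prod.Lex.lt_iff.mpr hq), hlt⟩
  · rintro ⟨p, hp, hlt⟩
    exact ⟨toLex (p.2, p.1),
      fun q hq => hp ((ofLex q).2, (ofLex q).1) (Prod.Lex.lt_iff.mp hq), hlt⟩

/-- The map on variables that moves column `j` to column `π j`. -/
def moveColumns (c : ℕ) (π : ℕ+ → ℕ+) (p : Fin c × ℕ+) : Fin c × ℕ+ :=
  (p.1, π p.2)

theorem moveColumns_injective (c : ℕ) {π : ℕ+ → ℕ+} (hπ : Function.Injective π) :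
    Function.Injective (moveColumns c π) := fun _ _ h =>
  Prod.ext (Prod.ext_iff.mp h).1 (hπ (Prod.ext_iff.mp h).2)

/-- A strictly increasing map preserves the order of the variables, so the largest variable where
the exponents differ moves to the largest one afterwards; outside the image both exponents vanish.
-/
theorem mapDomain_moveColumns_lt {c : ℕ} {π : ℕ+ → ℕ+} (hπ : StrictMono π)
    {u v : Fin c × ℕ+ →₀ ℕ} (h : (columnOrder c).toSyn u < (columnOrder c).toSyn v) :
    (columnOrder c).toSyn (u.mapDomain (moveColumns c π)) <
      (columnOrder c).toSyn (v.mapDomain (moveColumns c π)) := by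
  have hinj := moveColumns_injective c hπ.injective
  rw [columnOrder_lt_iff] at h ⊢
  obtain ⟨p, hp, hlt⟩ := h
  refine ⟨moveColumns c π p, fun q hq => ?_, ?_⟩
  · by_cases hr : q ∈ Set.range (moveColumns c π)
    · obtain ⟨q, rfl⟩ := hr
      rw [Finsupp.mapDomain_apply hinj, Finsupp.mapDomain_apply hinj]
      exact hp q (hq.imp hπ.lt_iff_lt.mp (And.imp_left fun h => hπ.injective h))
    · rw [Finsupp.mapDomain_of_notMem_range _ _ hr, Finsupp.mapDomain_of_notMem_range _ _ hr]
  · rwa [Finsupp.mapDomain_apply hinj, Finsupp.mapDomain_apply hinj]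

/-! ### Divisibility up to `Inc` via Higman's lemma -/

theorem exists_forall_column_eq_zero {c : ℕ} (u : Fin c × ℕ+ →₀ ℕ) :
    ∃ n : ℕ, ∀ i (j : ℕ), n ≤ j → u (i, j.succPNat) = 0 := by
  refine ⟨u.support.sup fun p => (p.2 : ℕ), fun i j hj => ?_⟩
  by_contra h
  have := Finset.le_sup (f := fun p : Fin c × ℕ+ => (p.2 : ℕ)) (Finsupp.mem_support_iff.mpr h)
  simp only [Nat.succPNat_coe] at this
  omega

/-- The word formed by the first `n` columns of an exponent matrix. -/
def columnWord {c : ℕ} (u : Fin c × ℕ+ →₀ ℕ) (n : ℕ) : List (Fin c → ℕ) :=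
  (List.range n).map fun j i => u (i, j.succPNat)

/-- An embedding between the column words of two monomials gives an element of `Inc` moving the
first monomial to a divisor of the second. -/
theorem exists_mapDomain_le_of_sublistForall₂ {c : ℕ} {u v : Fin c × ℕ+ →₀ ℕ} {n k : ℕ}
    (hu : ∀ i (j : ℕ), n ≤ j → u (i, j.succPNat) = 0)
    (h : List.SublistForall₂ (· ≤ ·) (columnWord u n) (columnWord v k)) :
    ∃ π : Inc, u.mapDomain (moveColumns c π.1) ≤ v := by
  obtain ⟨l, hl, hsub⟩ := List.sublistForall₂_iff.mp h
  obtain ⟨e, he⟩ := List.sublist_iff_exists_orderEmbedding_getElem?_eq.mp hsub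
  -- `e` embeds all of `ℕ`, so it also moves the columns past the word, where `u` vanishes. Columns
  -- count from 1, list positions from 0.
  have hπ : StrictMono fun j : ℕ+ => (e j.natPred).succPNat := fun a b hab =>
    Nat.succPNat_lt_succPNat.mpr (e.strictMono (PNat.natPred_lt_natPred.mpr hab))
  refine ⟨⟨fun j : ℕ+ => (e j.natPred).succPNat, hπ⟩, fun q => ?_⟩
  by_cases hr : q ∈ Set.range (moveColumns c fun j : ℕ+ => (e j.natPred).succPNat)
  · obtain ⟨⟨i, j⟩, rfl⟩ := hr
    refine (Finsupp.mapDomain_apply (moveColumns_injective c hπ.injective) u (i, j)).trans_le ?_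
    obtain ⟨j, rfl⟩ : ∃ t : ℕ, t.succPNat = j := ⟨j.natPred, PNat.succPNat_natPred j⟩
    simp only [moveColumns, Nat.natPred_succPNat]
    rcases le_or_gt n j with hj | hj
    · rw [hu i j hj]
      exact Nat.zero_le _
    · have hlen : j < (columnWord u n).length := by simpa [columnWord] using hj
      have hlen' : j < l.length := hl.length_eq ▸ hlen
      have h1 := hl.get hlen hlen'
      have h2 := he j
      rw [List.getElem?_eq_getElem hlen'] at h2
      obtain ⟨hlt, h3⟩ := List.getElem?_eq_some_iff.mp h2.symm
      rw [List.get_eq_getElem, List.get_eq_getElem] at h1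
      simp only [← h3] at h1
      simp only [columnWord, List.getElem_map, List.getElem_range] at h1
      exact h1 i
  · refine (Finsupp.mapDomain_of_notMem_range _ _ hr).trans_le (Nat.zero_le _)

/-- Columns lie in `ℕ^c`, well-quasi-ordered by Dickson's lemma; Higman's lemma passes this to
column words. -/
theorem exists_subseq_mapDomain_le {c : ℕ} (u : ℕ → Fin c × ℕ+ →₀ ℕ) :
    ∃ g : ℕ ↪o ℕ, ∀ k l, k ≤ l →
      ∃ π : Inc, (u (g k)).mapDomain (moveColumns c π.1) ≤ u (g l) := by
  choose n hn using fun k => exists_forall_column_eq_zero (u k)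
  have hcol : (Set.univ : Set (Fin c → ℕ)).PartiallyWellOrderedOn (· ≤ ·) :=
    Set.isPWO_of_wellQuasiOrderedLE _
  have : IsPreorder (List (Fin c → ℕ)) (List.SublistForall₂ (· ≤ ·)) := {}
  obtain ⟨g, hg⟩ := (Set.PartiallyWellOrderedOn.partiallyWellOrderedOn_sublistForall₂ _
    hcol).exists_monotone_subseq (f := fun k => columnWord (u k) (n k))
    fun _ _ _ => Set.mem_univ _
  exact ⟨g, fun k l hkl => exists_mapDomain_le_of_sublistForall₂ (hn _) (hg k l hkl)⟩

theorem isEquivariantlyNoetherian_incAction (c : ℕ) (K : Type*) [CommRing K]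
    [IsNoetherianRing K] : IsEquivariantlyNoetherian (incAction c K) := fun I hI =>
  exists_finset_eq_span_rename (columnOrder c) (fun π : Inc => moveColumns c π.1)
    (fun π => moveColumns_injective c (StrictMono.injective π.2))
    (fun π _ _ h => mapDomain_moveColumns_lt π.2 h) exists_subseq_mapDomain_le I hI

/-! ### From `Inc` to `Sym(∞)` -/

/-- An injective map agrees with an element of `Sym(∞)` on any finite set. -/
theorem exists_symInf_eqOn {π : ℕ+ → ℕ+} (hπ : Function.Injective π) (s : Finset ℕ+) :
    ∃ σ : SymInf, ∀ j ∈ s, σ.1 j = π j := by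
  -- The segment up to `N` contains `s` and its image, so the partial injection extends to a
  -- permutation of this finite segment, then by the identity.
  obtain ⟨N, hN⟩ := (s ∪ s.image π).bddAbove
  have hs : ∀ j ∈ s, j ≤ N := fun j hj => hN (by simp [hj])
  have hs' : ∀ j ∈ s, π j ≤ N := fun j hj =>
    hN (Finset.mem_coe.mpr (Finset.mem_union_right _ (Finset.mem_image_of_mem π hj)))
  have : Finite {j : ℕ+ // j ≤ N} := (Set.finite_Iic N).to_subtype
  let t : Set {j : ℕ+ // j ≤ N} := {j | j.1 ∈ s}
  let e : t → {j : ℕ+ // j ≤ N} := fun j => ⟨π j.1.1, hs' _ j.2⟩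
  have he : Function.Injective e := fun a b h =>
    Subtype.ext (Subtype.ext (hπ (congrArg Subtype.val h)))
  obtain ⟨τ, hτ⟩ := Equiv.Perm.exists_extending_pair
    (fun j : t => j.1) e Subtype.val_injective he
  refine ⟨⟨Equiv.Perm.ofSubtype τ, N, fun m hm =>
    Equiv.Perm.ofSubtype_apply_of_not_mem _ (not_le.mpr hm)⟩, fun j hj => ?_⟩
  refine (Equiv.Perm.ofSubtype_apply_of_mem τ (hs j hj)).trans ?_
  exact congrArg Subtype.val (hτ ⟨⟨j, hs j hj⟩, hj⟩)

/-- Only the finitely many columns occurring in `f` matter, so `σ` may depend on `f`. -/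
theorem exists_symAction_eq_incAction {c : ℕ} {K : Type*} [CommRing K] (π : Inc)
    (f : PolyRing c K) : ∃ σ : SymInf, symAction c K σ f = incAction c K π f := by
  classical
  obtain ⟨σ, hσ⟩ := exists_symInf_eqOn (StrictMono.injective π.2) (f.vars.image Prod.snd)
  refine ⟨σ, ?_⟩
  refine hom_congr_vars (f₁ := (symAction c K σ).toRingHom) (f₂ := (incAction c K π).toRingHom)
    (RingHom.ext fun a => ?_) (fun p hp _ => ?_) rfl
  · exact ((symAction c K σ).commutes a).trans ((incAction c K π).commutes a).symm
  · refine (symAction_X c K σ p.1 p.2).trans (Eq.trans ?_ (incAction_X c K π p.1 p.2).symm)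
    rw [hσ p.2 (Finset.mem_image_of_mem _ hp)]

theorem isEquivariantlyNoetherian_symAction (c : ℕ) (K : Type*) [CommRing K]
    [IsNoetherianRing K] : IsEquivariantlyNoetherian (symAction c K) := by
  intro I hI
  have hInc : IsInvariant (incAction c K) I := fun π f hf => by
    obtain ⟨σ, hσ⟩ := exists_symAction_eq_incAction π f
    exact hσ ▸ hI σ f hf
  obtain ⟨s, hs⟩ := isEquivariantlyNoetherian_incAction c K I hInc
  refine ⟨s, le_antisymm (hs.trans_le ?_) (Ideal.span_le.mpr (Set.iUnion₂_subset fun f hf => ?_))⟩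
  · refine Ideal.span_mono (Set.iUnion₂_mono fun f _ => ?_)
    rintro _ ⟨π, rfl⟩
    obtain ⟨σ, hσ⟩ := exists_symAction_eq_incAction π f
    exact ⟨σ, hσ⟩
  · rintro _ ⟨σ, rfl⟩
    refine hI σ f ?_
    rw [hs]
    refine Ideal.subset_span (Set.mem_biUnion hf ⟨1, ?_⟩)
    simp

end EquivariantNoeth

theorem mainTheorem3 {K : Type*} [CommRing K] [IsNoetherianRing K] (c : ℕ) :
    EquivariantNoeth.IsEquivariantlyNoetherian (EquivariantNoeth.incAction c K) ∧
      EquivariantNoeth.IsEquivariantlyNoetherian (EquivariantNoeth.symAction c K) :=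
  ⟨EquivariantNoeth.isEquivariantlyNoetherian_incAction c K,
    EquivariantNoeth.isEquivariantlyNoetherian_symAction c K⟩
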